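/- Let $G$ be a finite graph (parallel edges and loops are allowed). For a real number $r\ge 2$ and an integer $d\ge 1$, an $(r,d)$-NZF ($d$-dimensional nowhere-zero $r$-flow) on $G$ is an orientation of $G$ together with an assignment $\varphi\colon E(G)\to\mathbb{R}^d$ such that the Euclidean norm of $\varphi(e)$ lies in $[1,r-1]$ for every edge $e$ and, at every vertex, the sum of the vectors on the incoming edges equals the sum of the vectors on the outgoing edges. The $d$-dimensional flow number $\phi_d(G)$ is the infimum of the real numbers $r\ge 2$ such that $G$ admits an $(r,d)$-NZF. If $G$ is bridgeless, then $\phi_2(G)\le 1+\sqrt5$; moreover, $G$ admits a $(1+\sqrt5,2)$-NZF. -/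

import Mathlib

namespace Graph

variable {α β : Type*}

/-- `e` is a bridge of the multigraph `G`: it is an edge whose ends lie in different connected
components of `G - e`. (A loop is never a bridge.) -/
def IsBridge (G : Graph α β) (e : β) : Prop :=
  e ∈ G.edgeSet ∧
    ∀ x y : α, G.IsLink e x y → ¬ Relation.ReflTransGen (G.deleteEdges {e}).Adj x y

/-- `G` has no bridge. -/
def Bridgeless (G : Graph α β) : Prop :=
  ∀ e : β, ¬ G.IsBridge e

/-- An orientation of `G`: every edge is given one of its two possible directions. -/
structure Orientation (G : Graph α β) where
  /-- the tail of an edge -/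
  tail : G.edgeSet → α
  /-- the head of an edge -/
  head : G.edgeSet → α
  /-- the tail and the head of an edge are its two ends -/
  isLink : ∀ e : G.edgeSet, G.IsLink e (tail e) (head e)

open Classical in
/-- `φ` is a `d`-dimensional flow with respect to the orientation `O`: at every vertex the sum of
the vectors on the incoming edges equals the sum of the vectors on the outgoing edges. -/
def Orientation.IsFlow {G : Graph α β} [Fintype G.edgeSet] (O : G.Orientation) {d : ℕ}
    (φ : G.edgeSet → EuclideanSpace ℝ (Fin d)) : Prop :=
  ∀ v ∈ G.vertexSet,
    ∑ e : G.edgeSet with O.head e = v, φ e = ∑ e : G.edgeSet with O.tail e = v, φ e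

/-- `G` admits a `d`-dimensional nowhere-zero `r`-flow, an `(r, d)`-NZF: an orientation and a
`d`-dimensional flow, all of whose values have Euclidean norm in `[1, r - 1]`. -/
def HasNZF (G : Graph α β) [Fintype G.edgeSet] (r : ℝ) (d : ℕ) : Prop :=
  ∃ (O : G.Orientation) (φ : G.edgeSet → EuclideanSpace ℝ (Fin d)),
    O.IsFlow φ ∧ ∀ e : G.edgeSet, ‖φ e‖ ∈ Set.Icc (1 : ℝ) (r - 1)

/-- The `d`-dimensional flow number of `G`: the infimum of the real numbers `r ≥ 2` such that `G`
admits an `(r, d)`-NZF. (It is meaningful only when there is such an `r`.) -/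
noncomputable def flowNumber (G : Graph α β) [Fintype G.edgeSet] (d : ℕ) : ℝ :=
  sInf {r : ℝ | 2 ≤ r ∧ G.HasNZF r d}

end Graph

/-!
Every bridgeless graph has two integer flows `f` and `g` along a common orientation, with
`|f| ≤ 1` and `|g| ≤ 2` and no common zero; this is Seymour's 6-flow theorem
(`Multidigraph.exists_flow_pair`). The planar flow `(f, g)` then has norms between `1` and
`√(1 + 4) = √5`.

The 6-flow theorem is proved by induction on the number of vertices, for a multigraph with a fixed
orientation. If some nontrivial cut has no edge or two edges, two vertices on opposite sides of it
(the ends of a cut edge, if there is one) are identified; the flows of the smaller graph can be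
repaired, because the two edges of a two-edge cut carry the same absolute value
(`exists_flow_of_cut_eq_pair`).

Otherwise all nontrivial cuts have at least three edges. A vertex set `U` is *good* if it induces a
connected subgraph carrying a `{0, 1, -1}`-flow `f` such that every integer weighting can be
changed on the edges inside `U`, without changing its divergence, to become nonzero modulo `3` on
all those edges where `f` vanishes (`IsGood`). Two disjoint good sets joined by two edges merge to
a good set, since a cycle through two new edges can be added with a suitable coefficient modulo `3`
(`Absorbs.insert_insert`, `IsGood.union`). A maximal good set `U` is everything: a minimal set
`H` outside `U` with at most one edge to the rest of the complement induces a bridgeless subgraph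
and is joined to `U` by two edges; the ends of these in `H` lie on a closed trail in `H`, obtained
from two edge-disjoint paths, whose vertex set is good (`exists_isGood_of_two_le_cuts`) and so
merges with `U`. Correcting the zero weighting now gives a flow modulo `3` that is nonzero where `f`
vanishes, and Tutte's augmentation argument lifts it to an integer flow with absolute values at
most two (`exists_small_flow_modEq`).
-/

/-- A multigraph with a fixed reference orientation: `e` runs from `src e` to `tgt e`. -/
structure Multidigraph (V E : Type*) where
  /-- the tail of an edge -/
  src : E → V
  /-- the head of an edge -/
  tgt : E → V

namespace Multidigraph

open Finset

variable {V E : Type*} [Fintype E] [DecidableEq V] (D : Multidigraph V E)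

/-! ### Divergence and cuts -/

/-- The net outflow of an integer edge weighting at each vertex; its kernel is the space of
integer flows. -/
def div : (E → ℤ) →ₗ[ℤ] (V → ℤ) :=
  Fintype.linearCombination ℤ (fun e => Pi.single (D.src e) 1 - Pi.single (D.tgt e) 1)

lemma div_apply (f : E → ℤ) (v : V) :
    D.div f v = ∑ e, f e * ((if D.src e = v then 1 else 0) - if D.tgt e = v then 1 else 0) := by
  simp [div, Fintype.linearCombination_apply, Finset.sum_apply, Pi.single_apply, eq_comm]

lemma div_single [DecidableEq E] (e : E) (k : ℤ) :
    D.div (Pi.single e k) = k • (Pi.single (D.src e) 1 - Pi.single (D.tgt e) 1) := by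
  simp [div, Fintype.linearCombination_apply_single]

lemma sum_div (f : E → ℤ) (X : Finset V) :
    ∑ v ∈ X, D.div f v =
      ∑ e, f e * ((if D.src e ∈ X then 1 else 0) - if D.tgt e ∈ X then 1 else 0) := by
  simp only [div_apply]
  rw [Finset.sum_comm]
  refine Finset.sum_congr rfl fun e _ => ?_
  rw [← Finset.mul_sum, Finset.sum_sub_distrib]
  simp

lemma sum_univ_div [Fintype V] (f : E → ℤ) : ∑ v, D.div f v = 0 := by
  simp [sum_div]

/-- The edges with both ends in `U`. -/
def inside (U : Finset V) : Set E := {e | D.src e ∈ U ∧ D.tgt e ∈ U}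

/-- The edges with one end in `A` and one end in `B`. -/
def between (A B : Finset V) : Finset E :=
  univ.filter fun e => (D.src e ∈ A ∧ D.tgt e ∈ B) ∨ (D.src e ∈ B ∧ D.tgt e ∈ A)

/-- The edges with exactly one end in `X`. -/
def cut (X : Finset V) : Finset E := univ.filter fun e => ¬(D.src e ∈ X ↔ D.tgt e ∈ X)

lemma mem_cut {X : Finset V} {e : E} : e ∈ D.cut X ↔ ¬(D.src e ∈ X ↔ D.tgt e ∈ X) := by
  simp [cut]

lemma div_eq_zero_of_notMem {f : E → ℤ} {H : Finset V} (hf : ∀ e, f e ≠ 0 → e ∈ D.inside H)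
    {v : V} (hv : v ∉ H) : D.div f v = 0 := by
  rw [div_apply]
  refine Finset.sum_eq_zero fun e _ => ?_
  by_cases h : f e = 0
  · simp [h]
  · obtain ⟨h1, h2⟩ := hf e h
    have hs : D.src e ≠ v := fun hs => hv (hs ▸ h1)
    have ht : D.tgt e ≠ v := fun ht => hv (ht ▸ h2)
    simp [hs, ht]

lemma exists_div_single_of_mem_between [DecidableEq E] {A B : Finset V} {e : E} (he : e ∈ D.between A B) :
    ∃ σ : ℤ, (σ = 1 ∨ σ = -1) ∧ ∃ a ∈ A, ∃ b ∈ B,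
      D.div (Pi.single e σ) = Pi.single a 1 - Pi.single b 1 := by
  simp only [between, mem_filter, mem_univ, true_and] at he
  rcases he with ⟨h1, h2⟩ | ⟨h1, h2⟩
  · exact ⟨1, by simp, _, h1, _, h2, by simp [div_single]⟩
  · exact ⟨-1, by simp, _, h2, _, h1, by simp [div_single]⟩

/-! ### Augmenting paths -/

/-- Reachability along permitted arcs, where `A e 1` permits the edge `e` forwards and `A e (-1)`
permits it backwards: there is a set `R` that no permitted arc leaves, and each `w ∈ R` is the end
of a path of permitted arcs from `u`, given as a `{0, 1, -1}`-valued weighting. -/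
theorem exists_reach [Fintype V] [DecidableEq E] (A : E → ℤ → Prop) (u : V) :
    ∃ R : Finset V, u ∈ R ∧
      (∀ w ∈ R, ∃ g : E → ℤ,
        (∀ e, g e ≠ 0 → e ∈ D.inside R ∧ (g e = 1 ∨ g e = -1) ∧ A e (g e)) ∧
        D.div g = Pi.single u 1 - Pi.single w 1) ∧
      (∀ e, D.src e ∈ R → D.tgt e ∉ R → ¬ A e 1) ∧
      (∀ e, D.src e ∉ R → D.tgt e ∈ R → ¬ A e (-1)) := by
  classical
  let P : Finset V → Prop := fun R => u ∈ R ∧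
      (∀ w ∈ R, ∃ g : E → ℤ,
        (∀ e, g e ≠ 0 → e ∈ D.inside R ∧ (g e = 1 ∨ g e = -1) ∧ A e (g e)) ∧
        D.div g = Pi.single u 1 - Pi.single w 1)
  have h0 : P {u} := by
    refine ⟨by simp, fun w hw => ⟨0, by simp, ?_⟩⟩
    rw [mem_singleton] at hw
    simp [hw]
  obtain ⟨R, hR, hmax⟩ := Finset.exists_max_image (univ.filter P) Finset.card ⟨{u}, by simpa using h0⟩
  rw [mem_filter] at hR
  -- An arc from `R` to a new vertex is disjoint from all paths inside `R`, so it extends one.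
  have key : ∀ w ∈ R, ∀ w' ∉ R, ∀ e σ, (σ = 1 ∨ σ = -1) → A e σ → e ∉ D.inside R →
      e ∈ D.inside (insert w' R) →
      D.div (Pi.single e σ) = Pi.single w 1 - Pi.single w' 1 → False := by
    intro w hw w' hw' e σ hσ hA heR heR' hd
    have hsub : D.inside R ⊆ D.inside (insert w' R) := fun e he =>
      ⟨mem_insert_of_mem he.1, mem_insert_of_mem he.2⟩
    have : P (insert w' R) := by
      refine ⟨mem_insert_of_mem hR.2.1, fun z hz => ?_⟩
      rcases mem_insert.1 hz with rfl | hz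
      · obtain ⟨g, hg, hgd⟩ := hR.2.2 w hw
        have hge : g e = 0 := by
          by_contra h
          exact heR (hg e h).1
        refine ⟨g + Pi.single e σ, fun e' he' => ?_, ?_⟩
        · by_cases h : e' = e
          · subst h
            simpa [hge, heR', hA] using hσ
          · simp only [Pi.add_apply, Pi.single_eq_of_ne h, add_zero] at he' ⊢
            exact ⟨hsub (hg e' he').1, (hg e' he').2⟩
        · rw [map_add, hgd, hd]
          abel
      · obtain ⟨g, hg, hgd⟩ := hR.2.2 z hz
        exact ⟨g, fun e' he' => ⟨hsub (hg e' he').1, (hg e' he').2⟩, hgd⟩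
    have := hmax (insert w' R) (by simpa using this)
    rw [card_insert_of_notMem hw'] at this
    omega
  refine ⟨R, hR.2.1, hR.2.2, fun e h1 h2 hA => ?_, fun e h1 h2 hA => ?_⟩
  · exact key _ h1 _ h2 e 1 (by simp) hA (fun h => h2 h.2)
      ⟨mem_insert_of_mem h1, mem_insert_self _ _⟩ (by simp [div_single])
  · exact key _ h2 _ h1 e (-1) (by simp) hA (fun h => h1 h.1)
      ⟨mem_insert_self _ _, mem_insert_of_mem h2⟩ (by simp [div_single])

/-! ### From flows modulo three to integer flows -/

/-- Tutte's lifting argument: among the representatives modulo `3` with values in `[-2, 2]`, one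
with least total absolute divergence is a flow. -/
theorem exists_small_flow_modEq [Fintype V] [DecidableEq E] (h : E → ℤ) (hh : D.div h = 0) :
    ∃ g : E → ℤ, D.div g = 0 ∧ ∀ e, |g e| ≤ 2 ∧ (3 : ℤ) ∣ g e - h e := by
  have main : ∀ (n : ℕ) (g : E → ℤ), ∑ v, (D.div g v).natAbs = n → (∀ v, (3 : ℤ) ∣ D.div g v) →
      (∀ e, |g e| ≤ 2 ∧ (3 : ℤ) ∣ g e - h e) →
      ∃ g : E → ℤ, D.div g = 0 ∧ ∀ e, |g e| ≤ 2 ∧ (3 : ℤ) ∣ g e - h e := by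
    intro n
    induction n using Nat.strong_induction_on with
    | _ n ih =>
      intro g hn h3 hg
      by_cases h0 : D.div g = 0
      · exact ⟨g, h0, hg⟩
      obtain ⟨v, hv⟩ := Function.ne_iff.1 h0
      obtain ⟨u, -, hu⟩ := Finset.exists_pos_of_sum_zero_of_exists_nonzero _ (D.sum_univ_div g)
        ⟨v, mem_univ v, hv⟩
      obtain ⟨R, huR, hR, hout, hin⟩ := D.exists_reach (fun e σ => 0 < σ * g e) u
      -- No positive amount of `g` leaves `R`, while `u` has positive divergence.
      obtain ⟨w, hwR, hw⟩ : ∃ w ∈ R, D.div g w < 0 := by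
        by_contra! hc
        have h1 : 0 < ∑ v ∈ R, D.div g v := Finset.sum_pos' hc ⟨u, huR, hu⟩
        rw [sum_div] at h1
        refine absurd h1 (not_lt.2 (Finset.sum_nonpos fun e _ => ?_))
        have := hout e
        have := hin e
        by_cases hs : D.src e ∈ R <;> by_cases ht : D.tgt e ∈ R <;> simp_all
      obtain ⟨p, hp, hpd⟩ := hR w hwR
      have huw : u ≠ w := by
        rintro rfl
        omega
      have hd : ∀ v, D.div (g - (3 : ℤ) • p) v =
          D.div g v - 3 * ((if v = u then 1 else 0) - if v = w then 1 else 0) := by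
        intro v
        rw [map_sub, map_smul, hpd]
        simp [Pi.single_apply]
      refine ih _ ?_ (g - (3 : ℤ) • p) rfl (fun v => ?_) (fun e => ?_)
      · rw [← hn]
        have h3u := h3 u
        have h3w := h3 w
        refine Finset.sum_lt_sum (fun v _ => ?_) ⟨u, mem_univ u, ?_⟩
        · rw [hd]
          by_cases h1 : v = u
          · subst h1
            rw [if_pos rfl, if_neg huw]
            omega
          · by_cases h2 : v = w
            · subst h2
              rw [if_neg h1, if_pos rfl]
              omega
            · rw [if_neg h1, if_neg h2]
              simp
        · rw [hd, if_pos rfl, if_neg huw]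
          omega
      · rw [hd]
        exact dvd_sub (h3 v) (dvd_mul_right _ _)
      · obtain ⟨ha, hb⟩ := hg e
        rw [abs_le] at ha ⊢
        simp only [Pi.sub_apply, Pi.smul_apply, smul_eq_mul]
        by_cases hpe : p e = 0
        · rw [hpe]
          omega
        · obtain ⟨-, h1 | h1, h2⟩ := hp e hpe <;> rw [h1] at h2 ⊢ <;> omega
  refine main _ (fun e => h e % 3) rfl (fun v => ?_) (fun e => ?_)
  · have h1 : (fun e => h e % 3) = h - (3 : ℤ) • fun e => h e / 3 := by
      funext e
      simp only [Pi.sub_apply, Pi.smul_apply, smul_eq_mul]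
      omega
    rw [h1, map_sub, hh, map_smul]
    simp
  · rw [abs_le]
    omega

/-! ### Absorbing edge sets -/

/-- `X` absorbs all corrections outside `F`: every integer weighting can be modified on `X` only,
without changing its divergence, so as to become nonzero modulo `3` on all of `X` except `F`. -/
def Absorbs (X F : Set E) : Prop :=
  ∀ h : E → ℤ, ∃ h' : E → ℤ, D.div h' = D.div h ∧ (∀ e ∉ X, h' e = h e) ∧
    ∀ e ∈ X, e ∉ F → ¬ (3 : ℤ) ∣ h' e

/-- `x` and `y` are joined by an integer unit flow supported on `X`. -/
def Linked (X : Set E) (x y : V) : Prop :=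
  ∃ p : E → ℤ, (∀ e ∉ X, p e = 0) ∧ D.div p = Pi.single x 1 - Pi.single y 1

variable {D}

lemma Linked.symm {X : Set E} {x y : V} (h : D.Linked X x y) : D.Linked X y x := by
  obtain ⟨p, hp, hd⟩ := h
  exact ⟨-p, fun e he => by simp [hp e he], by rw [map_neg, hd]; abel⟩

lemma Linked.trans {X : Set E} {x y z : V} (h : D.Linked X x y) (h' : D.Linked X y z) :
    D.Linked X x z := by
  obtain ⟨p, hp, hd⟩ := h
  obtain ⟨q, hq, hd'⟩ := h'
  exact ⟨p + q, fun e he => by simp [hp e he, hq e he], by rw [map_add, hd, hd']; abel⟩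

lemma Linked.mono {X Y : Set E} (hXY : X ⊆ Y) {x y : V} (h : D.Linked X x y) :
    D.Linked Y x y := by
  obtain ⟨p, hp, hd⟩ := h
  exact ⟨p, fun e he => hp e (fun h => he (hXY h)), hd⟩

lemma Absorbs.union {X Y F F' : Set E} (hX : D.Absorbs X F) (hY : D.Absorbs Y F')
    (hXY : Disjoint X Y) : D.Absorbs (X ∪ Y) (F ∪ F') := by
  intro h
  obtain ⟨h₁, hd₁, ho₁, hn₁⟩ := hX h
  obtain ⟨h₂, hd₂, ho₂, hn₂⟩ := hY h₁
  refine ⟨h₂, hd₂.trans hd₁, fun e he => ?_, fun e he hF => ?_⟩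
  · rw [ho₂ e fun h => he (Or.inr h), ho₁ e fun h => he (Or.inl h)]
  · rcases he with he | he
    · rw [ho₂ e (Set.disjoint_left.1 hXY he)]
      exact hn₁ e he fun h => hF (Or.inl h)
    · exact hn₂ e he fun h => hF (Or.inr h)

/-- Seymour's closure step: a cycle with at most two edges outside `X` can be added to `X`, since
at most two of the three multiples of the cycle modulo `3` are excluded by the new edges. -/
lemma Absorbs.insert_insert {X F : Set E} (hX : D.Absorbs X F) {c : E → ℤ} (hc : D.div c = 0)
    {e₁ e₂ : E} (hsupp : ∀ e ∉ X, e ≠ e₁ → e ≠ e₂ → c e = 0)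
    (h₁ : ¬ (3 : ℤ) ∣ c e₁) (h₂ : ¬ (3 : ℤ) ∣ c e₂) :
    D.Absorbs (insert e₁ (insert e₂ X)) F := by
  intro h
  obtain ⟨k, hk₁, hk₂⟩ : ∃ k : ℤ, ¬ (3 : ℤ) ∣ h e₁ + k * c e₁ ∧ ¬ (3 : ℤ) ∣ h e₂ + k * c e₂ := by
    by_contra! hcon
    have h0 := hcon 0
    have h1 := hcon 1
    have h2 := hcon 2
    omega
  obtain ⟨h', hd, ho, hn⟩ := hX (h + k • c)
  refine ⟨h', by rw [hd, map_add, map_smul, hc, smul_zero, add_zero], fun e he => ?_, fun e he hF => ?_⟩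
  · simp only [Set.mem_insert_iff, not_or] at he
    rw [ho e he.2.2]
    simp [hsupp e he.2.2 he.1 he.2.1]
  · by_cases heX : e ∈ X
    · exact hn e heX hF
    · rw [ho e heX]
      rcases he with rfl | rfl | he
      · exact hk₁
      · exact hk₂
      · exact absurd he heX

/-- An absorbing edge set that connects `U` stays absorbing when all edges inside `U` are added:
each of them closes a cycle with it. -/
lemma Absorbs.inside [DecidableEq E] {X F : Set E} {U : Finset V} (hX : D.Absorbs X F) (hXU : X ⊆ D.inside U)
    (hU : ∀ x ∈ U, ∀ y ∈ U, D.Linked X x y) : D.Absorbs (D.inside U) F := by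
  suffices h : D.Absorbs (X ∪ D.inside U) F by rwa [Set.union_eq_self_of_subset_left hXU] at h
  refine Set.Finite.induction_on_subset (motive := fun Y _ => D.Absorbs (X ∪ Y) F) _
    (Set.toFinite (D.inside U)) (by simpa using hX) ?_
  intro e Y he _ _ hY
  rw [Set.union_insert]
  by_cases heX : e ∈ X ∪ Y
  · rwa [Set.insert_eq_of_mem heX]
  obtain ⟨p, hp, hd⟩ := hU _ he.2 _ he.1
  have hpe : p e = 0 := hp e fun h => heX (Or.inl h)
  have := hY.insert_insert (c := Pi.single e 1 + p) (e₁ := e) (e₂ := e)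
    (by rw [map_add, hd, div_single]; simp)
    (fun e' he' hne _ => by simp [hne, hp e' fun h => he' (Or.inl h)])
    (by simp [hpe]) (by simp [hpe])
  simpa using this

variable (D)

/-- `U` induces a connected subgraph, and `f` is a flow on it with values in `{0, 1, -1}` such that
the edges inside `U` absorb all corrections outside the support of `f`. -/
structure IsGood (U : Finset V) (f : E → ℤ) : Prop where
  abs_le : ∀ e, |f e| ≤ 1
  div_eq : D.div f = 0
  supp : ∀ e, f e ≠ 0 → e ∈ D.inside U
  linked : ∀ x ∈ U, ∀ y ∈ U, D.Linked (D.inside U) x y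
  absorbs : D.Absorbs (D.inside U) {e | f e ≠ 0}

variable {D}

lemma isGood_of_linked_support [DecidableEq E] {U : Finset V} {f : E → ℤ} (h1 : ∀ e, |f e| ≤ 1)
    (hd : D.div f = 0) (hs : ∀ e, f e ≠ 0 → e ∈ D.inside U)
    (hl : ∀ x ∈ U, ∀ y ∈ U, D.Linked {e | f e ≠ 0} x y) : D.IsGood U f := by
  refine ⟨h1, hd, hs, fun x hx y hy => (hl x hx y hy).mono hs, Absorbs.inside ?_ hs hl⟩
  exact fun h => ⟨h, rfl, fun _ _ => rfl, fun e he he' => absurd he he'⟩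

lemma isGood_singleton [DecidableEq E] (u : V) : D.IsGood {u} 0 := by
  refine isGood_of_linked_support (by simp) (by simp) (by simp) fun x hx y hy => ⟨0, by simp, ?_⟩
  rw [mem_singleton] at hx hy
  simp [hx, hy]

/-- Two disjoint good sets joined by two edges merge: the two edges lie on a common cycle whose
other edges are inside the two sets. -/
lemma IsGood.union [DecidableEq E] {U W : Finset V} {f f' : E → ℤ} (hU : D.IsGood U f) (hW : D.IsGood W f')
    (hUW : Disjoint U W) {e₁ e₂ : E} (h₁ : e₁ ∈ D.between U W) (h₂ : e₂ ∈ D.between U W)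
    (hne : e₁ ≠ e₂) : D.IsGood (U ∪ W) (f + f') := by
  have hUW' := Finset.disjoint_left.1 hUW
  have hdisj : Disjoint (D.inside U) (D.inside W) :=
    Set.disjoint_left.2 fun e h h' => hUW' h.1 h'.1
  have hff : ∀ e, f e = 0 ∨ f' e = 0 := by
    intro e
    by_contra! h
    exact Set.disjoint_left.1 hdisj (hU.supp e h.1) (hW.supp e h.2)
  have hnot : ∀ e ∈ D.between U W, e ∉ D.inside U ∧ e ∉ D.inside W := by
    intro e he
    simp only [between, mem_filter, mem_univ, true_and] at he
    refine ⟨fun h => ?_, fun h => ?_⟩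
    · rcases he with he | he
      · exact hUW' h.2 he.2
      · exact hUW' h.1 he.1
    · rcases he with he | he
      · exact hUW' he.1 h.1
      · exact hUW' he.2 h.2
  have hsubU : D.inside U ⊆ D.inside (U ∪ W) := fun e he =>
    ⟨mem_union_left _ he.1, mem_union_left _ he.2⟩
  have hsubW : D.inside W ⊆ D.inside (U ∪ W) := fun e he =>
    ⟨mem_union_right _ he.1, mem_union_right _ he.2⟩
  have hbtw : ∀ e ∈ D.between U W, e ∈ D.inside (U ∪ W) := by
    intro e he
    simp only [between, mem_filter, mem_univ, true_and] at he
    rcases he with he | he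
    · exact ⟨mem_union_left _ he.1, mem_union_right _ he.2⟩
    · exact ⟨mem_union_right _ he.1, mem_union_left _ he.2⟩
  obtain ⟨σ₁, hσ₁, a₁, ha₁, b₁, hb₁, hd₁⟩ := D.exists_div_single_of_mem_between h₁
  obtain ⟨σ₂, hσ₂, a₂, ha₂, b₂, hb₂, hd₂⟩ := D.exists_div_single_of_mem_between h₂
  obtain ⟨p, hp, hpd⟩ := hU.linked a₂ ha₂ a₁ ha₁
  obtain ⟨q, hq, hqd⟩ := hW.linked b₁ hb₁ b₂ hb₂
  have hcyc := (hU.absorbs.union hW.absorbs hdisj).insert_insert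
    (c := Pi.single e₁ σ₁ - Pi.single e₂ σ₂ + p + q) (e₁ := e₁) (e₂ := e₂)
    (by rw [map_add, map_add, map_sub, hd₁, hd₂, hpd, hqd]; abel)
    (fun e he hne₁ hne₂ => by
      simp [hne₁, hne₂, hp e fun h => he (Or.inl h), hq e fun h => he (Or.inr h)])
    (by
      simp only [Pi.add_apply, Pi.sub_apply, Pi.single_eq_same, Pi.single_eq_of_ne hne,
        hp _ (hnot _ h₁).1, hq _ (hnot _ h₁).2]
      omega)
    (by
      simp only [Pi.add_apply, Pi.sub_apply, Pi.single_eq_same, Pi.single_eq_of_ne hne.symm,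
        hp _ (hnot _ h₂).1, hq _ (hnot _ h₂).2]
      omega)
  have hlinked : ∀ x ∈ U ∪ W, ∀ y ∈ U ∪ W,
      D.Linked (insert e₁ (insert e₂ (D.inside U ∪ D.inside W))) x y := by
    have hbase : ∀ x ∈ U ∪ W, D.Linked (insert e₁ (insert e₂ (D.inside U ∪ D.inside W))) x a₁ := by
      intro x hx
      rcases mem_union.1 hx with hx | hx
      · exact (hU.linked x hx a₁ ha₁).mono fun e he => Or.inr (Or.inr (Or.inl he))
      · refine ((hW.linked x hx b₁ hb₁).mono fun e he => Or.inr (Or.inr (Or.inr he))).trans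
          (Linked.symm ⟨Pi.single e₁ σ₁, fun e he => ?_, hd₁⟩)
        exact Pi.single_eq_of_ne (fun h => he (Or.inl h)) _
    exact fun x hx y hy => (hbase x hx).trans (hbase y hy).symm
  have hsub : insert e₁ (insert e₂ (D.inside U ∪ D.inside W)) ⊆ D.inside (U ∪ W) := by
    rintro e (rfl | rfl | he | he)
    · exact hbtw _ h₁
    · exact hbtw _ h₂
    · exact hsubU he
    · exact hsubW he
  have hset : {e | f e ≠ 0} ∪ {e | f' e ≠ 0} = {e | (f + f') e ≠ 0} := by
    ext e
    rcases hff e with h | h <;> simp [h]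
  refine ⟨fun e => ?_, by rw [map_add, hU.div_eq, hW.div_eq, add_zero], fun e he => ?_,
    fun x hx y hy => (hlinked x hx y hy).mono hsub, ?_⟩
  · rcases hff e with h | h
    · simpa [h] using hW.abs_le e
    · simpa [h] using hU.abs_le e
  · rcases hff e with h | h
    · exact hsubW (hW.supp e (by simpa [h] using he))
    · exact hsubU (hU.supp e (by simpa [h] using he))
  · rw [← hset]
    exact hcyc.inside hsub hlinked

/-! ### Two edge-disjoint paths -/

/-- If every cut of `D[H]` has two edges, a flow of value at most one from `u₁` to `u₂` inside `H`
can be augmented. -/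
lemma exists_augmentation [Fintype V] [DecidableEq E] {H : Finset V}
    (hH : ∀ A ⊆ H, A.Nonempty → A ≠ H → 2 ≤ (D.between A (H \ A)).card)
    {u₁ u₂ : V} (hu₁ : u₁ ∈ H) (hu₂ : u₂ ∈ H) {f : E → ℤ} {k : ℤ} (hk : k ≤ 1)
    (hf : ∀ e, |f e| ≤ 1) (hs : ∀ e, f e ≠ 0 → e ∈ D.inside H)
    (hd : D.div f = k • (Pi.single u₁ 1 - Pi.single u₂ 1)) :
    ∃ f' : E → ℤ, (∀ e, |f' e| ≤ 1) ∧ (∀ e, f' e ≠ 0 → e ∈ D.inside H) ∧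
      D.div f' = (k + 1) • (Pi.single u₁ 1 - Pi.single u₂ 1) := by
  obtain ⟨R, huR, hR, hout, hin⟩ :=
    D.exists_reach (fun e σ => e ∈ D.inside H ∧ σ * f e ≤ 0) u₁
  have hRH : R ⊆ H := by
    intro w hw
    obtain ⟨g, hg, hgd⟩ := hR w hw
    by_contra hwH
    have hne : w ≠ u₁ := by
      rintro rfl
      exact hwH hu₁
    have := D.div_eq_zero_of_notMem (fun e he => (hg e he).2.2.1) hwH
    simp [hgd, hne] at this
  by_cases hu₂R : u₂ ∈ R
  · obtain ⟨g, hg, hgd⟩ := hR u₂ hu₂R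
    refine ⟨f + g, fun e => ?_, fun e he => ?_, by rw [map_add, hd, hgd, add_smul, one_smul]⟩
    · have h1 := hf e
      rw [abs_le] at h1 ⊢
      by_cases hge : g e = 0
      · simpa [hge] using h1
      · obtain ⟨-, h2 | h2, -, h3⟩ := hg e hge <;> rw [h2] at h3 <;>
          simp only [Pi.add_apply, h2] <;> omega
    · by_cases hge : g e = 0
      · exact hs e (by simpa [hge] using he)
      · exact (hg e hge).2.2.1
  · -- Every edge of `D[H]` leaving `R` is saturated outwards, so the value of `f` is at least two.
    exfalso
    have h2 := hH R hRH ⟨u₁, huR⟩ (fun h => hu₂R (h ▸ hu₂))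
    have hsum : ∑ v ∈ R, D.div f v = k := by
      rw [hd]
      simp [← Finset.mul_sum, Finset.sum_sub_distrib, Pi.single_apply, huR, hu₂R]
    have hcard : ((D.between R (H \ R)).card : ℤ) ≤ ∑ v ∈ R, D.div f v := by
      rw [sum_div, Finset.card_eq_sum_ones, between, Finset.sum_filter]
      push_cast
      refine Finset.sum_le_sum fun e _ => ?_
      have h1 := abs_le.1 (hf e)
      have hsupp := hs e
      have ho := hout e
      have hi := hin e
      simp only [inside, Set.mem_ofPred_eq, mem_sdiff] at *
      have hRs := @hRH (D.src e)
      have hRt := @hRH (D.tgt e)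
      by_cases hes : D.src e ∈ R <;> by_cases het : D.tgt e ∈ R
      · simp [hes, het]
      · by_cases hetH : D.tgt e ∈ H
        · have := ho hes het
          simp only [hRs hes, hetH, and_self, true_and, not_le] at this
          simp [hes, het, hetH]
          omega
        · have : f e = 0 := by
            by_contra h
            exact hetH (hsupp h).2
          simp [hes, het, hetH, this]
      · by_cases hesH : D.src e ∈ H
        · have := hi hes het
          simp only [hRt het, hesH, and_self, true_and, not_le] at this
          simp [hes, het, hesH]
          omega
        · have : f e = 0 := by
            by_contra h
            exact hesH (hsupp h).1
          simp [hes, het, hesH, this]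
      · simp [hes, het]
    omega

/-- If every cut of `D[H]` has two edges, then any two vertices of `H` lie in a common good subset
of `H`: two edge-disjoint paths between them form a closed trail. -/
lemma exists_isGood_of_two_le_cuts [Fintype V] [DecidableEq E] {H : Finset V}
    (hH : ∀ A ⊆ H, A.Nonempty → A ≠ H → 2 ≤ (D.between A (H \ A)).card)
    {u₁ u₂ : V} (hu₁ : u₁ ∈ H) (hu₂ : u₂ ∈ H) :
    ∃ W ⊆ H, u₁ ∈ W ∧ u₂ ∈ W ∧ ∃ f : E → ℤ, D.IsGood W f := by
  rcases eq_or_ne u₁ u₂ with rfl | hne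
  · exact ⟨{u₁}, by simpa using hu₁, by simp, by simp, 0, isGood_singleton u₁⟩
  obtain ⟨f₁, hf₁, hs₁, hd₁⟩ := exists_augmentation hH hu₁ hu₂ (f := 0) (k := 0) (by norm_num)
    (by simp) (by simp) (by simp)
  obtain ⟨f, hf, hs, hd⟩ := exists_augmentation hH hu₁ hu₂ (by norm_num) hf₁ hs₁ hd₁
  rw [show (0 + 1 + 1 : ℤ) = 2 by norm_num] at hd
  -- Split off one unit `p` of the flow `f` of value two and reverse it, which gives a circulation.
  obtain ⟨p, hp, hpd⟩ : ∃ p : E → ℤ, (∀ e, p e ≠ 0 → p e = f e) ∧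
      D.div p = Pi.single u₁ 1 - Pi.single u₂ 1 := by
    obtain ⟨R, huR, hR, hout, hin⟩ := D.exists_reach (fun e σ => f e = σ) u₁
    by_cases hu₂R : u₂ ∈ R
    · obtain ⟨g, hg, hgd⟩ := hR u₂ hu₂R
      exact ⟨g, fun e he => (hg e he).2.2.symm, hgd⟩
    · exfalso
      have hsum : ∑ v ∈ R, D.div f v = 2 := by
        rw [hd]
        simp [← Finset.mul_sum, Finset.sum_sub_distrib, Pi.single_apply, huR, hu₂R]
      have hle : ∑ v ∈ R, D.div f v ≤ 0 := by
        rw [sum_div]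
        refine Finset.sum_nonpos fun e _ => ?_
        have h1 := abs_le.1 (hf e)
        have ho := hout e
        have hi := hin e
        by_cases hes : D.src e ∈ R <;> by_cases het : D.tgt e ∈ R <;> simp [hes, het] at ho hi ⊢ <;>
          omega
      omega
  obtain ⟨c, hc⟩ : ∃ c : E → ℤ, c = f - (2 : ℤ) • p := ⟨_, rfl⟩
  have hce : ∀ e, c e = f e ∨ c e = -f e ∧ p e ≠ 0 := by
    intro e
    by_cases h : p e = 0
    · left
      simp [hc, h]
    · right
      refine ⟨?_, h⟩
      simp only [hc, Pi.sub_apply, Pi.smul_apply, smul_eq_mul, hp e h]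
      ring
  have hcf : ∀ e, c e = 0 ↔ f e = 0 := by
    intro e
    rcases hce e with h | ⟨h, -⟩ <;> simp [h]
  have hcd : D.div c = 0 := by
    rw [hc, map_sub, map_smul, hpd, hd, sub_self]
  -- The component of `u₁` in the support of `c`.
  obtain ⟨R, huR, hR, hout, hin⟩ := D.exists_reach (fun e _ => c e ≠ 0) u₁
  have hclosed : ∀ e, c e ≠ 0 → (D.src e ∈ R ↔ D.tgt e ∈ R) := by
    intro e he
    have ho := hout e
    have hi := hin e
    tauto
  have hu₂R : u₂ ∈ R := by
    by_contra hu₂R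
    have hsum : ∑ v ∈ R, D.div p v = 1 := by
      rw [hpd]
      simp [Finset.sum_sub_distrib, Pi.single_apply, huR, hu₂R]
    rw [sum_div, Finset.sum_eq_zero] at hsum
    · simp at hsum
    · intro e _
      by_cases he : p e = 0
      · simp [he]
      · have : c e ≠ 0 := by
          rw [Ne, hcf, ← hp e he]
          exact he
        simp [hclosed e this]
  refine ⟨R, fun w hw => ?_, huR, hu₂R, fun e => if D.src e ∈ R then c e else 0,
    isGood_of_linked_support (fun e => ?_) ?_ (fun e he => ?_) ?_⟩
  · obtain ⟨g, hg, hgd⟩ := hR w hw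
    by_contra hwH
    have hne : w ≠ u₁ := by
      rintro rfl
      exact hwH hu₁
    have := D.div_eq_zero_of_notMem
      (fun e he => hs e fun h => (hg e he).2.2 ((hcf e).2 h)) hwH
    simp [hgd, hne] at this
  · split_ifs
    · rcases hce e with h | ⟨h, -⟩
      · rw [h]
        exact hf e
      · rw [h, abs_neg]
        exact hf e
    · simp
  · funext v
    by_cases hv : v ∈ R
    · refine Eq.trans ?_ (congrFun hcd v)
      rw [div_apply, div_apply]
      refine Finset.sum_congr rfl fun e _ => ?_
      by_cases h : c e = 0
      · simp [h]
      · by_cases hes : D.src e ∈ R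
        · simp [hes]
        · have het := fun h' => hes ((hclosed e h).2 h')
          have h1 : D.src e ≠ v := by
            rintro rfl
            exact hes hv
          have h2 : D.tgt e ≠ v := by
            rintro rfl
            exact het hv
          simp [h1, h2]
    · refine D.div_eq_zero_of_notMem (fun e he => ?_) hv
      simp only [ne_eq, ite_eq_right_iff, Classical.not_imp] at he
      exact ⟨he.1, (hclosed e he.2).1 he.1⟩
  · simp only [ne_eq, ite_eq_right_iff, Classical.not_imp] at he
    exact ⟨he.1, (hclosed e he.2).1 he.1⟩
  · have hbase : ∀ x ∈ R, D.Linked {e | (if D.src e ∈ R then c e else 0) ≠ 0} u₁ x := by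
      intro x hx
      obtain ⟨g, hg, hgd⟩ := hR x hx
      refine ⟨g, fun e he => ?_, hgd⟩
      by_contra h
      obtain ⟨h1, -, h2⟩ := hg e h
      exact he (by simpa [h1.1] using h2)
    exact fun x hx y hy => (hbase x hx).symm.trans (hbase y hy)

/-! ### Graphs without small cuts -/

/-- In a graph without nontrivial cuts of fewer than three edges, a maximal good set is everything:
otherwise take a minimal set `H` outside it that is joined to the rest of the outside by at most one
edge; then `D[H]` has no bridge, and two edges join `H` to the good set. -/
theorem exists_isGood_univ [Fintype V] [DecidableEq E] [Nonempty V]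
    (hD : ∀ X : Finset V, X.Nonempty → X ≠ univ → 3 ≤ (D.cut X).card) :
    ∃ f : E → ℤ, D.IsGood univ f := by
  classical
  obtain ⟨v₀⟩ := ‹Nonempty V›
  obtain ⟨U, hU, hmax⟩ := Finset.exists_max_image
    (univ.filter fun U : Finset V => U.Nonempty ∧ ∃ f : E → ℤ, D.IsGood U f) Finset.card
    ⟨{v₀}, by simpa using ⟨0, isGood_singleton v₀⟩⟩
  simp only [mem_filter, mem_univ, true_and] at hU hmax
  obtain ⟨hUne, f, hf⟩ := hU
  by_cases hUu : U = univ
  · exact ⟨f, hUu ▸ hf⟩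
  exfalso
  obtain ⟨H, hH, hmin⟩ := Finset.exists_min_image
    (univ.filter fun H : Finset V => H.Nonempty ∧ H ⊆ Uᶜ ∧ (D.between H (Uᶜ \ H)).card ≤ 1)
    Finset.card ⟨Uᶜ, by
      simp only [mem_filter, mem_univ, true_and, subset_refl, sdiff_self]
      refine ⟨by rwa [nonempty_iff_ne_empty, Ne, compl_eq_empty_iff], ?_⟩
      simp [between]⟩
  simp only [mem_filter, mem_univ, true_and] at hH hmin
  obtain ⟨hHne, hHU, hH1⟩ := hH
  have hHU' : ∀ v ∈ H, v ∉ U := fun v hv => mem_compl.1 (hHU hv)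
  have hcut : ∀ A ⊆ H, A.Nonempty → A ≠ H → 2 ≤ (D.between A (H \ A)).card := by
    intro A hA hAne hAH
    have hss : A ⊂ H := hA.ssubset_of_ne hAH
    have hBne : (H \ A).Nonempty := sdiff_nonempty.2 hss.2
    have hlarge : ∀ B ⊆ H, B.Nonempty → B.card < H.card →
        2 ≤ (D.between B (Uᶜ \ B)).card := by
      intro B hB hBne hBc
      by_contra! h
      have := hmin B ⟨hBne, hB.trans hHU, by omega⟩
      omega
    have hc : (H \ A).card < H.card := by
      have := card_sdiff_add_card_eq_card hA
      have := hAne.card_pos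
      omega
    have h1 := hlarge A hA hAne (card_lt_card hss)
    have h2 := hlarge (H \ A) sdiff_subset hBne hc
    have h3 : (D.between A (Uᶜ \ A)).card ≤
        (D.between A (H \ A)).card + (D.between A (Uᶜ \ H)).card := by
      refine (card_le_card fun e he => ?_).trans (card_union_le _ _)
      simp only [between, mem_union, mem_filter, mem_univ, true_and, mem_sdiff, mem_compl] at he ⊢
      grind
    have h4 : (D.between (H \ A) (Uᶜ \ (H \ A))).card ≤
        (D.between A (H \ A)).card + (D.between (H \ A) (Uᶜ \ H)).card := by
      refine (card_le_card fun e he => ?_).trans (card_union_le _ _)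
      simp only [between, mem_union, mem_filter, mem_univ, true_and, mem_sdiff, mem_compl] at he ⊢
      grind
    have h5 : (D.between A (Uᶜ \ H)).card + (D.between (H \ A) (Uᶜ \ H)).card ≤
        (D.between H (Uᶜ \ H)).card := by
      rw [← card_union_of_disjoint]
      · refine card_le_card fun e he => ?_
        have hs := @hA (D.src e)
        have ht := @hA (D.tgt e)
        simp only [between, mem_union, mem_filter, mem_univ, true_and, mem_sdiff, mem_compl] at he ⊢
        grind
      · refine Finset.disjoint_left.2 fun e he => ?_
        have hs := @hA (D.src e)
        have ht := @hA (D.tgt e)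
        simp only [between, mem_filter, mem_univ, true_and, mem_sdiff, mem_compl] at he ⊢
        grind
    omega
  have hHu : H ≠ univ := by
    rintro rfl
    obtain ⟨v, hv⟩ := hUne
    exact hHU' v (mem_univ v) hv
  have h3 := hD H hHne hHu
  have hle : (D.cut H).card ≤ (D.between U H).card + (D.between H (Uᶜ \ H)).card := by
    refine (card_le_card fun e he => ?_).trans (card_union_le _ _)
    simp only [cut, between, mem_union, mem_filter, mem_univ, true_and, mem_sdiff, mem_compl]
      at he ⊢
    grind
  obtain ⟨e₁, he₁, e₂, he₂, hne⟩ := one_lt_card.1 (show 1 < (D.between U H).card by omega)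
  have hend : ∀ e ∈ D.between U H, ∃ u ∈ H, ∀ W : Finset V, u ∈ W → e ∈ D.between U W := by
    intro e he
    simp only [between, mem_filter, mem_univ, true_and] at he ⊢
    rcases he with ⟨h1, h2⟩ | ⟨h1, h2⟩
    · exact ⟨_, h2, fun W hW => Or.inl ⟨h1, hW⟩⟩
    · exact ⟨_, h1, fun W hW => Or.inr ⟨hW, h2⟩⟩
  obtain ⟨u₁, hu₁, hW₁⟩ := hend e₁ he₁
  obtain ⟨u₂, hu₂, hW₂⟩ := hend e₂ he₂
  obtain ⟨W, hWH, h1, h2, f', hf'⟩ := exists_isGood_of_two_le_cuts hcut hu₁ hu₂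
  have hdisj : Disjoint U W := Finset.disjoint_left.2 fun v hv hvW => hHU' v (hWH hvW) hv
  have := hmax (U ∪ W) ⟨hUne.mono subset_union_left,
    f + f', hf.union hf' hdisj (hW₁ W h1) (hW₂ W h2) hne⟩
  rw [card_union_of_disjoint hdisj] at this
  have : 0 < W.card := card_pos.2 ⟨u₁, h1⟩
  omega

/-! ### Contracting small cuts -/

/-- The image of a multigraph under a map of its vertices; edges may become loops. -/
def map {V' : Type*} (D : Multidigraph V E) (π : V → V') : Multidigraph V' E where
  src := π ∘ D.src
  tgt := π ∘ D.tgt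

/-- The map identifying `y` with `x`. -/
def identify {x y : V} (hxy : x ≠ y) (v : V) : {v : V // v ≠ y} :=
  if h : v = y then ⟨x, hxy⟩ else ⟨v, h⟩

lemma identify_eq_iff {x y : V} (hxy : x ≠ y) {v : V} (hvx : v ≠ x) (hvy : v ≠ y) (w : V) :
    identify hxy w = ⟨v, hvy⟩ ↔ w = v := by
  unfold identify
  split_ifs with h
  · subst h
    simp [hvx.symm, hvy.symm]
  · simp

/-- A flow of the graph obtained by identifying two vertices is conserved at all other vertices. -/
lemma div_eq_zero_of_identify {x y : V} (hxy : x ≠ y) {f : E → ℤ}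
    (hf : (D.map (identify hxy)).div f = 0) {v : V} (hvx : v ≠ x) (hvy : v ≠ y) :
    D.div f v = 0 := by
  have := congrFun hf ⟨v, hvy⟩
  simpa [div_apply, map, identify_eq_iff hxy hvx hvy] using this

/-- A flow is recovered after the ends of an edge `e₀` of a two-edge cut are identified: the value
on `e₀` is corrected, and its absolute value is then the one on the other edge of the cut. -/
lemma exists_flow_of_cut_eq_pair [Fintype V] [DecidableEq E] {X : Finset V} {e₀ e₁ : E}
    (hne : e₀ ≠ e₁) (hX : D.cut X = {e₀, e₁}) (hxy : D.src e₀ ≠ D.tgt e₀) {f : E → ℤ}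
    (hf : (D.map (identify hxy)).div f = 0) :
    ∃ h : E → ℤ, D.div h = 0 ∧ (∀ e ≠ e₀, h e = f e) ∧ |h e₀| = |f e₁| := by
  obtain ⟨h, hh⟩ : ∃ h : E → ℤ, h = f - Pi.single e₀ (D.div f (D.src e₀)) := ⟨_, rfl⟩
  have hhe : ∀ e ≠ e₀, h e = f e := fun e he => by simp [hh, he]
  have hd : ∀ v, D.div h v = D.div f v - D.div f (D.src e₀) *
      ((if v = D.src e₀ then 1 else 0) - if v = D.tgt e₀ then 1 else 0) := by
    intro v
    simp [hh, div_single, Pi.single_apply]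
  have h0 : ∀ v ≠ D.tgt e₀, D.div h v = 0 := by
    intro v hv
    rw [hd]
    by_cases hvs : v = D.src e₀
    · simp [hvs, hxy]
    · simp [hvs, hv, div_eq_zero_of_identify hxy hf hvs hv]
  have hflow : D.div h = 0 := by
    funext v
    by_cases hv : v = D.tgt e₀
    · have := D.sum_univ_div h
      rw [Finset.sum_eq_single (D.tgt e₀) (fun v _ hv => h0 v hv) (by simp)] at this
      rw [hv]
      exact this
    · exact h0 v hv
  refine ⟨h, hflow, hhe, ?_⟩
  have hsum := D.sum_div h X
  rw [hflow, ← Finset.sum_subset (subset_univ (D.cut X)) (fun e _ he => by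
    rw [mem_cut, not_not] at he
    simp [he]), hX, Finset.sum_pair hne] at hsum
  have h₀ := D.mem_cut.1 (show e₀ ∈ D.cut X by simp [hX])
  have h₁ := D.mem_cut.1 (show e₁ ∈ D.cut X by simp [hX])
  rw [← hhe e₁ hne.symm, abs_eq_abs]
  by_cases a : D.src e₀ ∈ X <;> by_cases b : D.tgt e₀ ∈ X <;> by_cases c : D.src e₁ ∈ X <;>
    by_cases d : D.tgt e₁ ∈ X <;> simp [a, b, c, d] at h₀ h₁ hsum ⊢ <;> omega

/-! ### The 6-flow theorem -/

/-- Seymour's 6-flow theorem, with the flow given as a pair of integer flows, one with values of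
absolute value at most one and one with values of absolute value at most two. -/
theorem exists_flow_pair [Fintype V] [DecidableEq E] (D : Multidigraph V E)
    (hD : ∀ X, (D.cut X).card ≠ 1) :
    ∃ f g : E → ℤ, D.div f = 0 ∧ D.div g = 0 ∧
      ∀ e, |f e| ≤ 1 ∧ |g e| ≤ 2 ∧ (f e ≠ 0 ∨ g e ≠ 0) := by
  obtain ⟨n, hn⟩ : ∃ n, Fintype.card V = n := ⟨_, rfl⟩
  induction n using Nat.strong_induction_on generalizing V with
  | _ n ih =>
    have hcontract : ∀ x y : V, ∀ hxy : x ≠ y, ∃ f g : E → ℤ,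
        (D.map (identify hxy)).div f = 0 ∧ (D.map (identify hxy)).div g = 0 ∧
        ∀ e, |f e| ≤ 1 ∧ |g e| ≤ 2 ∧ (f e ≠ 0 ∨ g e ≠ 0) := by
      intro x y hxy
      refine ih _ ?_ (D.map (identify hxy)) (fun X => ?_) rfl
      · rw [← hn]
        exact Fintype.card_subtype_lt (x := y) (by simp)
      · have : (D.map (identify hxy)).cut X = D.cut (univ.filter fun v => identify hxy v ∈ X) := by
          ext e
          rw [mem_cut, mem_cut]
          simp [map]
        rw [this]
        exact hD _
    by_cases hsmall : ∃ X : Finset V, X.Nonempty ∧ X ≠ univ ∧ (D.cut X).card ≤ 2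
    · obtain ⟨X, ⟨x, hx⟩, hXu, hX2⟩ := hsmall
      obtain ⟨y, hy⟩ : ∃ y, y ∉ X := by
        by_contra! h
        exact hXu (eq_univ_of_forall h)
      have hX1 := hD X
      obtain h0 | h2 : (D.cut X).card = 0 ∨ (D.cut X).card = 2 := by omega
      · rw [card_eq_zero] at h0
        have hxy : x ≠ y := by
          rintro rfl
          exact hy hx
        -- No edge leaves `X`, so conservation at the merged vertex splits into both vertices.
        have hflow : ∀ f : E → ℤ, (D.map (identify hxy)).div f = 0 → D.div f = 0 := by
          intro f hf
          have hother := fun v hvx hvy => div_eq_zero_of_identify (v := v) hxy hf hvx hvy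
          have hx0 : D.div f x = 0 := by
            have hsum := D.sum_div f X
            rw [Finset.sum_eq_single x
              (fun v hv hvx => hother v hvx (by rintro rfl; exact hy hv)) (by simp [hx]),
              Finset.sum_eq_zero] at hsum
            · exact hsum
            · intro e _
              have : e ∉ D.cut X := by simp [h0]
              rw [mem_cut, not_not] at this
              simp [this]
          have hy0 : D.div f y = 0 := by
            have hsum := D.sum_univ_div f
            rwa [Finset.sum_eq_single y (fun v _ hvy => ?_) (by simp)] at hsum
            by_cases hvx : v = x
            · rw [hvx, hx0]
            · exact hother v hvx hvy
          funext v
          by_cases hvx : v = x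
          · rw [hvx, hx0, Pi.zero_apply]
          by_cases hvy : v = y
          · rw [hvy, hy0, Pi.zero_apply]
          exact hother v hvx hvy
        obtain ⟨f, g, hf, hg, hfg⟩ := hcontract x y hxy
        exact ⟨f, g, hflow f hf, hflow g hg, hfg⟩
      · obtain ⟨e₀, e₁, hne, hXe⟩ := card_eq_two.1 h2
        have hxy : D.src e₀ ≠ D.tgt e₀ := by
          intro h
          have := D.mem_cut.1 (show e₀ ∈ D.cut X by simp [hXe])
          simp [h] at this
        obtain ⟨f, g, hf, hg, hfg⟩ := hcontract _ _ hxy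
        obtain ⟨f', hf', hfe, hf₀⟩ := exists_flow_of_cut_eq_pair hne hXe hxy hf
        obtain ⟨g', hg', hge, hg₀⟩ := exists_flow_of_cut_eq_pair hne hXe hxy hg
        refine ⟨f', g', hf', hg', fun e => ?_⟩
        by_cases he : e = e₀
        · rw [he, hf₀, hg₀, ← abs_pos (a := f' e₀), ← abs_pos (a := g' e₀), hf₀, hg₀, abs_pos,
            abs_pos]
          exact hfg e₁
        · rw [hfe e he, hge e he]
          exact hfg e
    · push Not at hsmall
      rcases isEmpty_or_nonempty V with hV | hV
      · exact ⟨0, 0, by simp, by simp, fun e => (hV.false (D.src e)).elim⟩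
      obtain ⟨f, hf⟩ := exists_isGood_univ (D := D) fun X h1 h2 => hsmall X h1 h2
      obtain ⟨h, hh, -, hh3⟩ := hf.absorbs 0
      obtain ⟨g, hg, hge⟩ := D.exists_small_flow_modEq h (by rw [hh, map_zero])
      refine ⟨f, g, hf.div_eq, hg, fun e => ⟨hf.abs_le e, (hge e).1, ?_⟩⟩
      by_contra! hcon
      refine hh3 e ⟨mem_univ _, mem_univ _⟩ (by simpa using hcon.1) ?_
      have := (hge e).2
      rw [hcon.2] at this
      omega

end Multidigraph

/-! ### Planar flows of graphs -/

namespace Graph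

open Finset

variable {α β : Type*}

/-- Reading a multigraph along an orientation. -/
def Orientation.toMultidigraph {G : Graph α β} (O : G.Orientation) :
    Multidigraph G.vertexSet G.edgeSet where
  src e := ⟨O.tail e, (O.isLink e).left_mem⟩
  tgt e := ⟨O.head e, (O.isLink e).right_mem⟩

/-- An edge that is alone in a cut is a bridge. -/
lemma Bridgeless.card_cut_ne_one {G : Graph α β} [Fintype G.edgeSet]
    [DecidableEq G.vertexSet] (hG : G.Bridgeless) (O : G.Orientation) (X : Finset G.vertexSet) :
    (O.toMultidigraph.cut X).card ≠ 1 := by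
  intro h
  obtain ⟨e, he⟩ := card_eq_one.1 h
  let inX : α → Prop := fun a => ∃ h : a ∈ G.vertexSet, (⟨a, h⟩ : G.vertexSet) ∈ X
  have hends : ∀ (e' : G.edgeSet) (x y : α), G.IsLink e' x y →
      (¬(inX x ↔ inX y) ↔ e' ∈ O.toMultidigraph.cut X) := by
    intro e' x y hxy
    rw [Multidigraph.mem_cut]
    have hs : O.toMultidigraph.src e' ∈ X ↔ inX (O.tail e') :=
      ⟨fun h => ⟨_, h⟩, fun ⟨_, h⟩ => h⟩
    have ht : O.toMultidigraph.tgt e' ∈ X ↔ inX (O.head e') :=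
      ⟨fun h => ⟨_, h⟩, fun ⟨_, h⟩ => h⟩
    rw [hs, ht]
    rcases hxy.eq_and_eq_or_eq_and_eq (O.isLink e') with ⟨rfl, rfl⟩ | ⟨rfl, rfl⟩
    · rfl
    · rw [iff_comm (a := inX (O.head e'))]
  refine hG e ⟨e.2, fun x y hxy hpath => (hends e x y hxy).2 (by simp [he]) ?_⟩
  clear hxy
  induction hpath with
  | refl => rfl
  | tail _ hadj ih =>
    refine ih.trans ?_
    obtain ⟨e', he'⟩ := hadj
    rw [deleteEdges_isLink] at he'
    by_contra hne
    have := (hends ⟨e', he'.1.edge_mem⟩ _ _ he'.1).1 hne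
    rw [he, mem_singleton] at this
    exact he'.2 (by simp [← this])

/-- Two integer flows combine to a flow in the plane. -/
lemma Orientation.isFlow_pair {G : Graph α β} [Fintype G.edgeSet] [DecidableEq G.vertexSet]
    (O : G.Orientation) {f g : G.edgeSet → ℤ} (hf : O.toMultidigraph.div f = 0)
    (hg : O.toMultidigraph.div g = 0) :
    O.IsFlow (d := 2) fun e => !₂[(f e : ℝ), (g e : ℝ)] := by
  classical
  have key : ∀ (f : G.edgeSet → ℤ), O.toMultidigraph.div f = 0 → ∀ v ∈ G.vertexSet,
      ∑ e : G.edgeSet with O.head e = v, (f e : ℝ) =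
        ∑ e : G.edgeSet with O.tail e = v, (f e : ℝ) := by
    intro f hf v hv
    have := congrFun hf ⟨v, hv⟩
    rw [Multidigraph.div_apply] at this
    simp only [Orientation.toMultidigraph, Subtype.mk.injEq, mul_sub, Finset.sum_sub_distrib,
      mul_ite, mul_one, mul_zero, Pi.zero_apply, ← Finset.sum_filter] at this
    exact_mod_cast (sub_eq_zero.1 this).symm
  intro v hv
  ext i
  fin_cases i
  · simpa using key f hf v hv
  · simpa using key g hg v hv

end Graph

theorem theorem6 {α β : Type*} (G : Graph α β) [Finite G.vertexSet] [Fintype G.edgeSet]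
    (hG : G.Bridgeless) :
    G.HasNZF (1 + Real.sqrt 5) 2 ∧ G.flowNumber 2 ≤ 1 + Real.sqrt 5 := by
  classical
  have := Fintype.ofFinite G.vertexSet
  have hNZF : G.HasNZF (1 + Real.sqrt 5) 2 := by
    choose tail head hlink using fun e : G.edgeSet => Graph.exists_isLink_of_mem_edgeSet e.2
    let O : G.Orientation := ⟨tail, head, hlink⟩
    obtain ⟨f, g, hf, hg, hfg⟩ := O.toMultidigraph.exists_flow_pair (hG.card_cut_ne_one O)
    refine ⟨O, _, O.isFlow_pair hf hg, fun e => ?_⟩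
    obtain ⟨h1, h2, h3⟩ := hfg e
    rw [EuclideanSpace.norm_eq, add_sub_cancel_left]
    have hsq : (∑ i, ‖(!₂[(f e : ℝ), (g e : ℝ)] : EuclideanSpace ℝ (Fin 2)) i‖ ^ 2) =
        ((f e ^ 2 + g e ^ 2 : ℤ) : ℝ) := by
      simp
    rw [hsq]
    have hf2 : f e ^ 2 ≤ 1 := by
      rw [← sq_abs]
      nlinarith [abs_nonneg (f e)]
    have hg2 : g e ^ 2 ≤ 4 := by
      rw [← sq_abs]
      nlinarith [abs_nonneg (g e)]
    have hpos : 1 ≤ f e ^ 2 + g e ^ 2 := by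
      rcases h3 with h | h
      · have := pow_pos (abs_pos.2 h) 2
        rw [sq_abs] at this
        nlinarith [sq_nonneg (g e)]
      · have := pow_pos (abs_pos.2 h) 2
        rw [sq_abs] at this
        nlinarith [sq_nonneg (f e)]
    constructor
    · rw [Real.one_le_sqrt]
      exact_mod_cast hpos
    · refine Real.sqrt_le_sqrt ?_
      exact_mod_cast (by omega : f e ^ 2 + g e ^ 2 ≤ 5)
  refine ⟨hNZF, csInf_le ⟨2, fun r hr => hr.1⟩ ⟨?_, hNZF⟩⟩
  have : (1 : ℝ) ≤ Real.sqrt 5 := Real.one_le_sqrt.2 (by norm_num)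
  linarith
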